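/- For an integer $m\ge 0$ let $\overline{p}(m)$ denote the number of overpartitions of $m$, i.e. partitions of $m$ in which the first occurrence of each distinct part may be overlined (so $\overline{p}(0)=1$), and put $\overline{p}(m)=0$ for $m<0$. For integers $n,k\ge 1$ let $$\overline{M}_k(n):=(-1)^k\sum_{j=-k}^{k}(-1)^j\,\overline{p}(n-j^2).$$ Theorem. (a) Let $\varepsilon>0$ and $C>0$. As $n\to\infty$, one has, uniformly for integers $k$ with $1\le k\le C\,n^{\frac1{12}-\varepsilon}$, $$\overline{M}_k(n)=\frac18\,n^{-1}e^{\pi\sqrt n}+O\!\left(k^3n^{-\frac54}e^{\pi\sqrt n}\right),$$ where the implied constant depends at most on $\varepsilon$ and $C$; that is, there are $K>0$ and $N$, depending only on $\varepsilon$ and $C$, such that $$\left|\overline{M}_k(n)-\frac18\,n^{-1}e^{\pi\sqrt n}\right|\le K\,k^3n^{-\frac54}e^{\pi\sqrt n}$$ for all integers $n\ge \max(N,1)$ and all integers $k$ with $1\le k\le C\,n^{\frac1{12}-\varepsilon}$. (b) The main term coincides with that of $\overline{p}(n)$: $\ \overline{p}(n)\sim \frac18\,n^{-1}e^{\pi\sqrt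 n}$ as $n\to\infty$. -/

import Mathlib

/-- An overpartition of `n`: a partition of `n` in which the first occurrence of each distinct
part may be overlined.  It is recorded as the underlying partition together with the set of those
part sizes whose first occurrence is overlined. -/
@[ext]
structure Overpartition (n : ℕ) where
  toPartition : n.Partition
  overlined : Finset ℕ
  overlined_subset : overlined ⊆ toPartition.parts.toFinset

/-- Overpartitions of `n` as pairs of a partition of `n` and a subset of its set of parts. -/
def Overpartition.equivSigma (n : ℕ) :
    Overpartition n ≃ (p : n.Partition) × {S // S ∈ p.parts.toFinset.powerset} where
  toFun a := ⟨a.toPartition, a.overlined, Finset.mem_powerset.2 a.overlined_subset⟩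
  invFun b := ⟨b.1, b.2.1, Finset.mem_powerset.1 b.2.2⟩
  left_inv _ := rfl
  right_inv _ := rfl

instance Overpartition.instFintype (n : ℕ) : Fintype (Overpartition n) :=
  Fintype.ofEquiv _ (Overpartition.equivSigma n).symm

/-- The number of overpartitions of the integer `m`; it is `0` for negative `m`
(and `1` for `m = 0`). -/
def overpartitionCount (m : ℤ) : ℕ :=
  if 0 ≤ m then Fintype.card (Overpartition m.toNat) else 0

/-- The truncated overpartition function
`(-1)^k * ∑_{j=-k}^{k} (-1)^j * overpartitionCount (n - j^2)`. -/
noncomputable def truncatedOverpartition (k n : ℕ) : ℤ :=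
  (-1) ^ k * ∑ j ∈ Finset.Icc (-(k : ℤ)) (k : ℤ),
    (-1) ^ j.natAbs * (overpartitionCount ((n : ℤ) - j ^ 2) : ℤ)

/-!
The generating function of overpartitions is `G(q) = ∏ (1 + q ^ i) / (1 - q ^ i)`, and by an identity
of Gauss it is the reciprocal of the theta function `∑ (-1) ^ j q ^ (j ^ 2)`
(`Overpartition.series_mul_jacobiTheta₂`). The modular transformation of this theta function gives,
for `q = exp (-π s)` with `s` in a cone around the positive real axis,
`G(q) = √s / 2 * exp (π / (4 s)) * (1 + tiny)` (`Overpartition.exists_series_exp_mul_eq`), while the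
product gives an exponential saving over `G(|q|)` outside that cone
(`Overpartition.norm_series_le`).

With `x = 1 / (2 √n)`, Cauchy's formula on the circle `|q| = exp (-π x)` passes through the saddle
point `s = x` of `exp (π / (4 s) + π n s)`. Comparing the integrand with a Gaussian and integrating
the error yields `p̄(n) = exp (π √n) / (8 n) * (1 + O(n ^ (-1 / 4)))`
(`Overpartition.abs_overpartitionCount_sub_mainTerm_le`).

For the truncated sums, each `p̄(n - j ^ 2)` with `|j| ≤ k` equals the main term of `p̄(n)` up to a
relative error `O(k ^ 2 n ^ (-1 / 4))`. The signs `(-1) ^ (k + j)` add up to `1`, so the main terms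
combine to a single one, and the `2 k + 1` errors to a relative error `O(k ^ 3 n ^ (-1 / 4))`.

Gauss's identity is proved from a finite form (`Overpartition.thetaPartialSum_mul`), by induction on
the number of terms.
-/

namespace Overpartition

open Filter Topology Finset MeasureTheory
open scoped PowerSeries.WithPiTopology

/-! ### The generating function of overpartitions -/

/-- The finite product `∏_{i ≤ N} (1 + q ^ i) / (1 - q ^ i)`. -/
noncomputable def partialProduct {𝕜 : Type*} [Field 𝕜] (N : ℕ) (q : 𝕜) : 𝕜 :=
  ∏ i ∈ range N, (1 + q ^ (i + 1)) / (1 - q ^ (i + 1))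

/-- The formal power series `(1 + X ^ (i + 1)) / (1 - X ^ (i + 1)) = 1 + 2 X ^ (i + 1) + ⋯`. -/
noncomputable def factorSeries (i : ℕ) : PowerSeries ℝ :=
  PowerSeries.mk fun k => if (i + 1) ∣ k then (if k = 0 then 1 else 2) else 0

lemma factorSeries_eq (i : ℕ) :
    factorSeries i =
      1 + ∑' j : ℕ, (2 : ℝ) • (PowerSeries.X : PowerSeries ℝ) ^ ((i + 1) * (j + 1)) := by
  ext k
  have h := (Nat.Partition.summable_genFun_term (R := ℝ) (fun _ _ => 2) i).map_tsum
    (PowerSeries.coeff (R := ℝ) k) (PowerSeries.WithPiTopology.continuous_coeff ℝ k)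
  rw [map_add, h]
  simp only [factorSeries, PowerSeries.coeff_mk, PowerSeries.coeff_one, map_smul,
    PowerSeries.coeff_X_pow, smul_eq_mul, mul_ite, mul_one, mul_zero]
  split_ifs with hd hk
  · subst hk
    simp
  · obtain ⟨j, rfl⟩ := hd
    obtain ⟨j, rfl⟩ : ∃ j', j = j' + 1 := Nat.exists_eq_succ_of_ne_zero (by rintro rfl; simp at hk)
    rw [tsum_eq_single j]
    · simp
    · intro b hb
      rw [if_neg]
      intro h
      have := Nat.eq_of_mul_eq_mul_left (Nat.succ_pos i) h
      omega
  · rename_i hk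
    exact absurd (hk ▸ dvd_zero _) hd
  · have h0 : ∀ j, (if k = (i + 1) * (j + 1) then (2 : ℝ) else 0) = 0 := fun j =>
      if_neg fun h => hd ⟨j + 1, h⟩
    simp [h0]

/-- The coefficient of `X ^ n` in `∏_{i ≤ N} (1 + X ^ i) / (1 - X ^ i)`: the number of
overpartitions of `n` into parts at most `N`. -/
noncomputable def partialCount (N n : ℕ) : ℝ :=
  PowerSeries.coeff n (∏ i ∈ range N, factorSeries i)

lemma overpartitionCount_natCast (n : ℕ) :
    (overpartitionCount (n : ℤ) : ℝ) =
      PowerSeries.coeff n (Nat.Partition.genFun (R := ℝ) fun _ _ => 2) := by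
  rw [overpartitionCount, if_pos (Int.natCast_nonneg n), Int.toNat_natCast,
    Fintype.card_congr (Overpartition.equivSigma n), Fintype.card_sigma,
    Nat.Partition.coeff_genFun]
  push_cast
  refine Finset.sum_congr rfl fun p _ => ?_
  simp [Finsupp.prod]

lemma tendsto_partialCount (n : ℕ) :
    Tendsto (fun N => partialCount N n) atTop (𝓝 (overpartitionCount (n : ℤ) : ℝ)) := by
  have h := (Nat.Partition.hasProd_genFun (R := ℝ) fun _ _ => 2).tendsto_prod_nat
  have h2 := ((PowerSeries.WithPiTopology.continuous_coeff ℝ n).tendsto _).comp h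
  rw [overpartitionCount_natCast]
  refine h2.congr fun N => ?_
  simp only [Function.comp, partialCount, factorSeries_eq]

lemma coeff_factorSeries_nonneg (i k : ℕ) : 0 ≤ PowerSeries.coeff k (factorSeries i) := by
  rw [factorSeries, PowerSeries.coeff_mk]
  split_ifs <;> norm_num

lemma partialCount_succ (N n : ℕ) :
    partialCount (N + 1) n = ∑ p ∈ antidiagonal n,
      partialCount N p.1 * PowerSeries.coeff p.2 (factorSeries N) := by
  rw [partialCount, prod_range_succ, PowerSeries.coeff_mul]
  rfl

lemma partialCount_nonneg (N n : ℕ) : 0 ≤ partialCount N n := by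
  induction N generalizing n with
  | zero =>
    simp only [partialCount, range_zero, prod_empty, PowerSeries.coeff_one]
    split_ifs <;> norm_num
  | succ N ih =>
    rw [partialCount_succ]
    exact sum_nonneg fun p _ => mul_nonneg (ih _) (coeff_factorSeries_nonneg _ _)

lemma monotone_partialCount (n : ℕ) : Monotone fun N => partialCount N n := by
  refine monotone_nat_of_le_succ fun N => ?_
  rw [partialCount_succ]
  refine le_trans (le_of_eq ?_) (single_le_sum
    (f := fun p : ℕ × ℕ => partialCount N p.1 * PowerSeries.coeff p.2 (factorSeries N))
    (fun p _ => mul_nonneg (partialCount_nonneg _ _) (coeff_factorSeries_nonneg _ _))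
    (mem_antidiagonal.2 (show (n, 0).1 + (n, 0).2 = n from add_zero n)))
  simp [factorSeries]

lemma partialCount_le (N n : ℕ) : partialCount N n ≤ overpartitionCount (n : ℤ) :=
  (monotone_partialCount n).ge_of_tendsto (tendsto_partialCount n) N

lemma one_sub_pow_ne_zero {𝕜 : Type*} [NormedField 𝕜] {q : 𝕜} (hq : ‖q‖ < 1) (i : ℕ) :
    1 - q ^ (i + 1) ≠ 0 := by
  intro h
  have h1 : ‖q ^ (i + 1)‖ < 1 := by
    rw [norm_pow]; exact pow_lt_one₀ (norm_nonneg _) hq (by simp)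
  rw [← sub_eq_zero.1 h, norm_one] at h1
  exact lt_irrefl _ h1

lemma hasSum_factorSeries {𝕜 : Type*} [RCLike 𝕜] {q : 𝕜} (hq : ‖q‖ < 1) (i : ℕ) :
    HasSum (fun k => ((PowerSeries.coeff k (factorSeries i) : ℝ) : 𝕜) * q ^ k)
      ((1 + q ^ (i + 1)) / (1 - q ^ (i + 1))) := by
  have hinj : Function.Injective fun j : ℕ => (i + 1) * j :=
    fun a b h => Nat.eq_of_mul_eq_mul_left (Nat.succ_pos i) h
  rw [← hinj.hasSum_iff]
  · have h1 : ‖q ^ (i + 1)‖ < 1 := by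
      rw [norm_pow]; exact pow_lt_one₀ (norm_nonneg _) hq (by simp)
    have h2 := ((hasSum_geometric_of_norm_lt_one h1).mul_left 2).sub (hasSum_ite_eq 0 (1 : 𝕜))
    convert! h2 using 1
    · funext j
      rcases Nat.eq_zero_or_pos j with rfl | hj
      · simp [factorSeries]; norm_num
      · simp [factorSeries, hj.ne', pow_mul]
        exact Or.inl (RCLike.ofReal_ofNat 2)
    · field_simp [one_sub_pow_ne_zero hq i]
      ring
  · intro k hk
    have : ¬ (i + 1) ∣ k := fun ⟨j, hj⟩ => hk ⟨j, hj.symm⟩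
    simp [factorSeries, this]

lemma norm_coeff_mul_pow {𝕜 : Type*} [RCLike 𝕜] {a : ℝ} (ha : 0 ≤ a) (q : 𝕜) (k : ℕ) :
    ‖(a : 𝕜) * q ^ k‖ = a * ‖q‖ ^ k := by
  rw [norm_mul, norm_pow, RCLike.norm_ofReal, abs_of_nonneg ha]

lemma hasSum_partialCount {𝕜 : Type*} [RCLike 𝕜] (N : ℕ) {q : 𝕜} (hq : ‖q‖ < 1) :
    HasSum (fun n => (partialCount N n : 𝕜) * q ^ n) (partialProduct N q) := by
  induction N with
  | zero =>
    convert! hasSum_ite_eq 0 (1 : 𝕜) using 1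
    · funext n
      rcases Nat.eq_zero_or_pos n with rfl | hn
      · simp [partialCount]
      · simp [partialCount, PowerSeries.coeff_one, hn.ne']
  | succ N ih =>
    have hf := hasSum_factorSeries hq N
    have hs := (summable_norm_sum_mul_antidiagonal_of_summable_norm ih.summable.norm
      hf.summable.norm).of_norm.hasSum
    rw [← tsum_mul_tsum_eq_tsum_sum_antidiagonal_of_summable_norm ih.summable.norm
      hf.summable.norm, ih.tsum_eq, hf.tsum_eq] at hs
    rw [partialProduct, prod_range_succ]
    convert! hs using 1
    funext n
    rw [partialCount_succ, RCLike.ofReal_sum, sum_mul]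
    refine sum_congr rfl fun p hp => ?_
    rw [← mem_antidiagonal.1 hp, pow_add, RCLike.ofReal_mul]
    ring

lemma partialProduct_le_exp (N : ℕ) {r : ℝ} (h0 : 0 ≤ r) (h1 : r < 1) :
    partialProduct N r ≤ Real.exp (2 * r / (1 - r) ^ 2) := by
  have h1' : 0 < 1 - r := sub_pos.2 h1
  have key : ∀ i ∈ range N, (1 + r ^ (i + 1)) / (1 - r ^ (i + 1)) ≤
      Real.exp (2 / (1 - r) * r ^ (i + 1)) := by
    intro i _
    have hp : r ^ (i + 1) ≤ r := pow_le_of_le_one h0 h1.le (by simp)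
    have hp0 : 0 ≤ r ^ (i + 1) := by positivity
    have h2 : 0 < 1 - r ^ (i + 1) := by linarith
    calc (1 + r ^ (i + 1)) / (1 - r ^ (i + 1))
        = 2 * r ^ (i + 1) / (1 - r ^ (i + 1)) + 1 := by field_simp; ring
      _ ≤ 2 * r ^ (i + 1) / (1 - r) + 1 := by gcongr
      _ = 2 / (1 - r) * r ^ (i + 1) + 1 := by ring
      _ ≤ _ := Real.add_one_le_exp _
  have hgeo : ∑ i ∈ range N, r ^ (i + 1) ≤ r / (1 - r) := by
    have hs := (hasSum_geometric_of_lt_one h0 h1).mul_left r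
    have := sum_le_hasSum (range N) (fun i _ => by positivity) hs
    simpa [pow_succ', div_eq_mul_inv] using this
  calc partialProduct N r ≤ ∏ i ∈ range N, Real.exp (2 / (1 - r) * r ^ (i + 1)) :=
        prod_le_prod (fun i _ => div_nonneg (by positivity)
          (sub_nonneg.2 (pow_le_one₀ h0 h1.le))) key
    _ = Real.exp (2 / (1 - r) * ∑ i ∈ range N, r ^ (i + 1)) := by
        rw [← Real.exp_sum, mul_sum]
    _ ≤ Real.exp (2 / (1 - r) * (r / (1 - r))) := by gcongr
    _ = _ := by congr 1; field_simp

lemma norm_partialProduct_le_exp (N : ℕ) {q : ℂ} (hq : ‖q‖ < 1) :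
    ‖partialProduct N q‖ ≤ Real.exp (2 * ‖q‖ / (1 - ‖q‖) ^ 2) := by
  refine le_trans ?_ (partialProduct_le_exp N (norm_nonneg q) hq)
  rw [partialProduct, partialProduct, norm_prod]
  refine prod_le_prod (fun _ _ => norm_nonneg _) fun i _ => ?_
  have h2 : 0 < 1 - ‖q‖ ^ (i + 1) := sub_pos.2 (pow_lt_one₀ (norm_nonneg _) hq (by simp))
  rw [norm_div]
  gcongr
  · refine (norm_add_le _ _).trans ?_
    simp
  · have := norm_sub_norm_le 1 (q ^ (i + 1))
    simpa using this

/-- The generating function `∑ p̄(n) q ^ n` of overpartitions. -/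
noncomputable def series {𝕜 : Type*} [RCLike 𝕜] (q : 𝕜) : 𝕜 :=
  ∑' n : ℕ, (overpartitionCount (n : ℤ) : 𝕜) * q ^ n

/-- The terms are nonnegative and their partial sums are limits of partial sums of the finite
products, which are bounded by `partialProduct_le_exp`. -/
lemma summable_series_real {r : ℝ} (h0 : 0 ≤ r) (h1 : r < 1) :
    Summable fun n : ℕ => (overpartitionCount (n : ℤ) : ℝ) * r ^ n := by
  refine summable_of_sum_range_le (c := Real.exp (2 * r / (1 - r) ^ 2))
    (fun n => by positivity) fun M => ?_
  have ht : Tendsto (fun N => ∑ n ∈ range M, partialCount N n * r ^ n) atTop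
      (𝓝 (∑ n ∈ range M, (overpartitionCount (n : ℤ) : ℝ) * r ^ n)) :=
    tendsto_finsetSum _ fun n _ => (tendsto_partialCount n).mul_const _
  refine le_of_tendsto' ht fun N => ?_
  have hs := hasSum_partialCount (𝕜 := ℝ) N (q := r) (by rwa [Real.norm_of_nonneg h0])
  exact (sum_le_hasSum _ (fun n _ => mul_nonneg (partialCount_nonneg N n) (by positivity))
    hs).trans (partialProduct_le_exp N h0 h1)

lemma tendsto_partialProduct {𝕜 : Type*} [RCLike 𝕜] {q : 𝕜} (hq : ‖q‖ < 1) :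
    Tendsto (fun N => partialProduct N q) atTop (𝓝 (series q)) := by
  have h : Tendsto (fun N => ∑' n, (partialCount N n : 𝕜) * q ^ n) atTop (𝓝 (series q)) := by
    refine tendsto_tsum_of_dominated_convergence (summable_series_real (norm_nonneg q) hq)
      (fun n => ?_) (Eventually.of_forall fun N n => ?_)
    · have := ((RCLike.continuous_ofReal (K := 𝕜)).tendsto _).comp (tendsto_partialCount n)
      simpa using this.mul_const (q ^ n)
    · rw [norm_coeff_mul_pow (partialCount_nonneg N n)]
      exact mul_le_mul_of_nonneg_right (partialCount_le N n) (by positivity)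
  exact h.congr fun N => (hasSum_partialCount N hq).tsum_eq

lemma series_ofReal (r : ℝ) : series (r : ℂ) = (series r : ℝ) := by
  simp [series, Complex.ofReal_tsum]

/-! ### Bounds away from the positive real axis -/

/-- Comparing the logarithms term by term, only the first term of `∑ (|z| ^ m - Re z ^ m) / m` is
kept. -/
lemma norm_inv_one_sub_le {z : ℂ} (hz : ‖z‖ < 1) :
    ‖(1 - z)⁻¹‖ ≤ (1 - ‖z‖)⁻¹ * Real.exp (-(‖z‖ - z.re)) := by
  have h1 := Complex.hasSum_re (Complex.hasSum_taylorSeries_neg_log' hz)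
  have h2 := Complex.hasSum_re (Complex.hasSum_taylorSeries_neg_log' (z := (‖z‖ : ℂ)) (by simpa))
  have h3 := h2.sub h1
  have hne : 1 - z ≠ 0 := by
    intro h
    rw [← sub_eq_zero.1 h, norm_one] at hz
    exact lt_irrefl _ hz
  have hpos : 0 < 1 - ‖z‖ := sub_pos.2 hz
  have hterm : ∀ n : ℕ, 0 ≤ ((‖z‖ : ℂ) ^ (n + 1) / (n + 1)).re - (z ^ (n + 1) / (n + 1)).re := by
    intro n
    have e1 : ((‖z‖ : ℂ) ^ (n + 1) / (n + 1)).re = ‖z ^ (n + 1) / (n + 1)‖ := by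
      rw [norm_div, norm_pow]
      have : ‖(n + 1 : ℂ)‖ = n + 1 := by
        have := Complex.norm_natCast (n + 1)
        push_cast at this
        exact this
      rw [this, ← Complex.ofReal_re (‖z‖ ^ (n + 1) / (n + 1))]
      push_cast
      rfl
    rw [e1]
    exact sub_nonneg.2 (Complex.re_le_norm _)
  have h4 := le_hasSum h3 0 (fun n _ => hterm n)
  have e2 : (-Complex.log (1 - (‖z‖ : ℂ))).re = -Real.log (1 - ‖z‖) := by
    rw [Complex.neg_re, Complex.log_re]
    congr 2
    rw [← Complex.ofReal_one, ← Complex.ofReal_sub, Complex.norm_real, Real.norm_of_nonneg hpos.le]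
  rw [e2, Complex.neg_re, Complex.log_re] at h4
  simp only [zero_add, pow_one, Nat.cast_zero, div_one, Complex.ofReal_re] at h4
  rw [norm_inv, ← Real.exp_log (norm_pos_iff.2 hne), ← Real.exp_log hpos, ← Real.exp_neg,
    ← Real.exp_neg, ← Real.exp_add, Real.exp_le_exp]
  linarith

lemma norm_partialProduct_le (N : ℕ) {q : ℂ} (hq : ‖q‖ < 1) :
    ‖partialProduct N q‖ ≤ partialProduct N ‖q‖ *
      Real.exp (-∑ i ∈ range N, (‖q‖ ^ (i + 1) - (q ^ (i + 1)).re)) := by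
  rw [partialProduct, partialProduct, norm_prod, ← sum_neg_distrib, Real.exp_sum,
    ← prod_mul_distrib]
  refine prod_le_prod (fun _ _ => norm_nonneg _) fun i _ => ?_
  have h1 : ‖q ^ (i + 1)‖ < 1 := by
    rw [norm_pow]; exact pow_lt_one₀ (norm_nonneg _) hq (by simp)
  have h2 := norm_inv_one_sub_le h1
  have h3 : ‖1 + q ^ (i + 1)‖ ≤ 1 + ‖q ^ (i + 1)‖ := (norm_add_le _ _).trans (by simp)
  rw [div_eq_mul_inv, norm_mul, div_eq_mul_inv, mul_assoc, ← norm_pow]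
  exact mul_le_mul h3 h2 (norm_nonneg _) (by positivity)

/-- The generating function at `q` is smaller than at `|q|` by a factor that is exponential in the
defect of the geometric series. -/
lemma norm_series_le {q : ℂ} (hq : ‖q‖ < 1) :
    ‖series q‖ ≤ series ‖q‖ * Real.exp (-(‖q‖ / (1 - ‖q‖) - (q / (1 - q)).re)) := by
  have h1 := (tendsto_partialProduct hq).norm
  have h2 := tendsto_partialProduct (𝕜 := ℝ) (q := ‖q‖) (by simpa using hq)
  have h3 := ((hasSum_geometric_of_lt_one (norm_nonneg q) hq).mul_left ‖q‖).sub
    (Complex.hasSum_re ((hasSum_geometric_of_norm_lt_one hq).mul_left q))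
  have h4 := (Real.continuous_exp.tendsto _).comp h3.tendsto_sum_nat.neg
  refine le_of_tendsto_of_tendsto' h1 (?_ : Tendsto _ _ _) fun N => norm_partialProduct_le N hq
  simpa only [div_eq_mul_inv, pow_succ', Function.comp_def] using h2.mul h4

/-! ### Gauss's theta identity -/

/-- The symmetric partial sum `∑_{|j| ≤ N} (-1) ^ j q ^ (j ^ 2)` of the theta series. -/
def thetaPartialSum (N : ℕ) (q : ℂ) : ℂ :=
  1 + 2 * ∑ s ∈ range N, (-1) ^ (s + 1) * q ^ ((s + 1) ^ 2)

lemma partialProduct_succ_mul {q : ℂ} (hq : ‖q‖ < 1) (N : ℕ) :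
    partialProduct (N + 1) q * (1 - q ^ (N + 1)) = partialProduct N q * (1 + q ^ (N + 1)) := by
  have h := one_sub_pow_ne_zero hq N
  rw [partialProduct, prod_range_succ, partialProduct]
  field_simp

/-- Replacing `x` by `x * q` in the alternating sums occurring in `thetaPartialSum_mul`; the
recursion `partialProduct_succ_mul` makes the difference of the two sides telescope. -/
lemma sum_neg_pow_mul_partialProduct {q : ℂ} (hq : ‖q‖ < 1) (x : ℂ) (m : ℕ) :
    (1 + x) * ∑ s ∈ range m, (-x) ^ s * partialProduct s q + (-x) ^ m * partialProduct m q =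
      (1 - x * q) * ∑ s ∈ range m, (-(x * q)) ^ s * partialProduct s q +
        (-(x * q)) ^ m * partialProduct m q := by
  induction m with
  | zero => simp
  | succ m ih =>
    have h := partialProduct_succ_mul hq m
    rw [sum_range_succ, sum_range_succ]
    have e : (-(x * q)) ^ (m + 1) = (-x) ^ (m + 1) * q ^ (m + 1) := by
      rw [← mul_pow]; ring
    have e' : (-(x * q)) ^ m * (x * q) = -((-x) ^ (m + 1) * q ^ (m + 1)) := by
      rw [← e]; ring
    rw [e]
    linear_combination ih + (-x) ^ (m + 1) * h - partialProduct m q * e'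

/-- A finite form of Gauss's identity `∑ (-1) ^ j q ^ (j ^ 2) = ∏ (1 - q ^ i) / (1 + q ^ i)`. -/
lemma thetaPartialSum_mul {q : ℂ} (hq : ‖q‖ < 1) (n : ℕ) :
    thetaPartialSum n q * partialProduct n q =
      (1 + q ^ n) * ∑ s ∈ range n, (-q ^ n) ^ s * partialProduct s q +
        (-q ^ n) ^ n * partialProduct n q := by
  induction n with
  | zero => simp [thetaPartialSum]
  | succ n ih =>
    rw [sum_neg_pow_mul_partialProduct hq, ← pow_succ] at ih
    have h := partialProduct_succ_mul hq n
    have h0 := one_sub_pow_ne_zero hq n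
    have hS : thetaPartialSum (n + 1) q =
        thetaPartialSum n q + 2 * (-q ^ (n + 1)) ^ (n + 1) := by
      rw [thetaPartialSum, sum_range_succ, thetaPartialSum, neg_pow (q ^ (n + 1)), ← pow_mul, sq]
      ring
    rw [sum_range_succ, hS]
    generalize q ^ (n + 1) = x at *
    generalize ∑ s ∈ range n, (-x) ^ s * partialProduct s q = T at *
    refine mul_right_cancel₀ h0 ?_
    have e : (-x) ^ (n + 1) = -x * (-x) ^ n := pow_succ' _ _
    rw [e]
    linear_combination (1 + x) * ih + (thetaPartialSum n q + 2 * (-x * (-x) ^ n)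
      - (-x) * (-x) ^ n) * h

lemma tendsto_thetaPartialSum_mul {q : ℂ} (hq : ‖q‖ < 1) :
    Tendsto (fun n => thetaPartialSum n q * partialProduct n q) atTop (𝓝 1) := by
  set B := Real.exp (2 * ‖q‖ / (1 - ‖q‖) ^ 2) with hB
  have hB0 : 0 < B := Real.exp_pos _
  rw [← tendsto_add_atTop_iff_nat 1, tendsto_iff_norm_sub_tendsto_zero]
  have hlim := ((tendsto_self_mul_const_pow_of_lt_one (norm_nonneg q) hq).const_mul
    (1 + 3 * B)).comp (tendsto_add_atTop_nat 1)
  rw [mul_zero] at hlim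
  refine squeeze_zero (fun _ => norm_nonneg _) (fun n => ?_) hlim
  set y := q ^ (n + 1) with hy
  have hy1 : ‖y‖ ≤ 1 := by
    rw [hy, norm_pow]; exact pow_le_one₀ (norm_nonneg _) hq.le
  have hterm : ∀ s : ℕ, ‖(-y) ^ (s + 1) * partialProduct (s + 1) q‖ ≤ ‖y‖ * B := by
    intro s
    rw [norm_mul, norm_pow, norm_neg]
    exact mul_le_mul (pow_le_of_le_one (norm_nonneg _) hy1 (by simp))
      (norm_partialProduct_le_exp _ hq) (norm_nonneg _) (norm_nonneg _)
  have hsum : ‖∑ s ∈ range n, (-y) ^ (s + 1) * partialProduct (s + 1) q‖ ≤ n * (‖y‖ * B) := by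
    refine (norm_sum_le_of_le _ fun s _ => hterm s).trans ?_
    simp
  have e : thetaPartialSum (n + 1) q * partialProduct (n + 1) q - 1 =
      y + (1 + y) * ∑ s ∈ range n, (-y) ^ (s + 1) * partialProduct (s + 1) q +
        (-y) ^ (n + 1) * partialProduct (n + 1) q := by
    rw [thetaPartialSum_mul hq, sum_range_succ']
    simp [partialProduct]
    ring
  have h1y : ‖1 + y‖ ≤ 2 := (norm_add_le _ _).trans (by rw [norm_one]; linarith)
  have hyn : ‖y‖ = ‖q‖ ^ (n + 1) := by rw [hy, norm_pow]
  simp only [Function.comp]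
  rw [e, ← hyn]
  have hcalc : ‖y + (1 + y) * ∑ s ∈ range n, (-y) ^ (s + 1) * partialProduct (s + 1) q +
        (-y) ^ (n + 1) * partialProduct (n + 1) q‖ ≤ ‖y‖ + 2 * (n * (‖y‖ * B)) + ‖y‖ * B := by
    refine (norm_add₃_le ..).trans ?_
    rw [norm_mul (1 + y)]
    gcongr
    exact hterm n
  refine hcalc.trans ?_
  have hY := norm_nonneg y
  push_cast
  have := mul_nonneg (Nat.cast_nonneg (α := ℝ) n) hY
  have h2 := mul_nonneg this hB0.le
  have h3 := mul_nonneg hY hB0.le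
  nlinarith

lemma tendsto_thetaPartialSum {τ : ℂ} (hτ : 0 < τ.im) :
    Tendsto (fun N => thetaPartialSum N (Complex.exp (Real.pi * Complex.I * τ))) atTop
      (𝓝 (jacobiTheta₂ (1 / 2) τ)) := by
  set q := Complex.exp (Real.pi * Complex.I * τ) with hq
  have hterm : ∀ n : ℤ, jacobiTheta₂_term n (1 / 2) τ = (-1) ^ n.natAbs * q ^ (n.natAbs ^ 2) := by
    intro n
    rw [jacobiTheta₂_term, Complex.exp_add, hq, ← Complex.exp_nat_mul]
    congr 1
    · rw [show 2 * (Real.pi : ℂ) * Complex.I * n * (1 / 2) = n * (Real.pi * Complex.I) by ring,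
        Complex.exp_int_mul, Complex.exp_pi_mul_I]
      obtain ⟨m, rfl | rfl⟩ := n.eq_nat_or_neg
      · simp
      · simp [← inv_pow]
    · congr 1
      have : ((n.natAbs ^ 2 : ℕ) : ℂ) = (n : ℂ) ^ 2 := by
        rw [← Int.cast_natCast, Nat.cast_pow, Int.natAbs_sq]
        simp
      rw [this]
      ring
  have h := (hasSum_jacobiTheta₂_term (1 / 2) hτ).nat_add_neg
  have h2 := (h.tendsto_sum_nat.comp (tendsto_add_atTop_nat 1)).sub_const 1
  convert! h2 using 1
  · funext N
    simp only [Function.comp]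
    rw [sum_range_succ']
    simp only [hterm, thetaPartialSum, Int.natAbs_neg, Int.natAbs_natCast, ← two_mul, ← mul_sum]
    simp
    ring
  · rw [hterm 0]
    simp

/-- Gauss's identity: the generating function of overpartitions is the reciprocal of the theta
function `∑ (-1) ^ j q ^ (j ^ 2)`. -/
theorem series_mul_jacobiTheta₂ {τ : ℂ} (hτ : 0 < τ.im) :
    series (Complex.exp (Real.pi * Complex.I * τ)) * jacobiTheta₂ (1 / 2) τ = 1 := by
  have hq : ‖Complex.exp (Real.pi * Complex.I * τ)‖ < 1 := by
    rw [Complex.norm_exp, Real.exp_lt_one_iff]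
    simp
    positivity
  have h := (tendsto_thetaPartialSum hτ).mul (tendsto_partialProduct hq)
  rw [mul_comm]
  exact tendsto_nhds_unique h (tendsto_thetaPartialSum_mul hq)

/-! ### Behaviour near the positive real axis -/

/-- The modular transformation of the theta function turns the generating function into an
explicit factor, up to a relative error that is exponentially small in `Re (1 / s)`. -/
theorem exists_series_exp_mul_eq {s : ℂ} (hs : 0 < s.re) :
    ∃ E : ℂ, ‖E‖ ≤ Real.exp (-2 * Real.pi * (s⁻¹).re) / (1 - Real.exp (-2 * Real.pi * (s⁻¹).re)) ∧
      series (Complex.exp (-Real.pi * s)) * (2 * (1 + E)) =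
        s ^ (1 / 2 : ℂ) * Complex.exp (Real.pi / (4 * s)) := by
  have hs0 : s ≠ 0 := by rintro rfl; simp at hs
  have hc : 0 < (s⁻¹).re := by
    rw [Complex.inv_re]; exact div_pos hs (Complex.normSq_pos.2 hs0)
  set c := (s⁻¹).re with hc_def
  set ρ := Real.exp (-2 * Real.pi * c) with hρ
  have hρ0 : 0 < ρ := Real.exp_pos _
  have hρ1 : ρ < 1 := by
    rw [hρ, Real.exp_lt_one_iff]
    nlinarith [Real.pi_pos, mul_pos Real.pi_pos hc]
  set τ : ℂ := Complex.I * s with hτ_def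
  have hτ : 0 < τ.im := by simpa [hτ_def] using hs
  have hτ' : 0 < (-1 / τ).im := by
    have : -1 / τ = Complex.I * s⁻¹ := by
      rw [hτ_def]; field_simp; simp
    rw [this, Complex.I_mul_im]
    exact hc
  set g : ℕ → ℂ := fun n => Complex.exp (-Real.pi * (n * (n + 1)) * s⁻¹) with hg
  -- after the shift `n ↦ n + 1` the exponents are symmetric under `n ↦ -(n + 1)`
  have hshift : ∀ n : ℤ, jacobiTheta₂_term (n + 1) (1 / 2 / τ) (-1 / τ) =
      Complex.exp (-Real.pi * (n * (n + 1)) * s⁻¹) := by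
    intro n
    rw [jacobiTheta₂_term, hτ_def]
    congr 1
    field_simp
    push_cast
    ring_nf
  have hsum : HasSum (fun n => 2 * g n) (jacobiTheta₂ (1 / 2 / τ) (-1 / τ)) := by
    have h1 := (Equiv.addRight (1 : ℤ)).hasSum_iff.2 (hasSum_jacobiTheta₂_term (1 / 2 / τ) hτ')
    convert! h1.nat_add_neg_add_one using 1
    funext n
    simp only [Function.comp, Equiv.coe_addRight, hshift, hg]
    push_cast
    rw [two_mul]
    congr 2
    ring
  have hbound : ∀ n, ‖g (n + 1)‖ ≤ ρ * ρ ^ n := by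
    intro n
    rw [hg, Complex.norm_exp, ← pow_succ', hρ, ← Real.exp_nat_mul, Real.exp_le_exp]
    have e : (-(Real.pi : ℂ) * (((n + 1 : ℕ) : ℂ) * (((n + 1 : ℕ) : ℂ) + 1)) * s⁻¹).re =
        -Real.pi * ((n + 1) * (n + 2)) * c := by
      rw [hc_def, ← Complex.re_ofReal_mul]
      push_cast
      ring_nf
    rw [e]
    push_cast
    have h1 := mul_pos Real.pi_pos hc
    have h2 : 0 ≤ (n : ℝ) := Nat.cast_nonneg n
    nlinarith [mul_nonneg (mul_nonneg h2 (by linarith : (0 : ℝ) ≤ n + 1)) h1.le]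
  have hgeo := (hasSum_geometric_of_lt_one hρ0.le hρ1).mul_left ρ
  refine ⟨∑' n, g (n + 1), ?_, ?_⟩
  · rw [div_eq_mul_inv]
    exact tsum_of_norm_bounded hgeo hbound
  · have hsg : Summable g := by
      have := hsum.summable.mul_left (1 / 2)
      simpa using this
    have hE : jacobiTheta₂ (1 / 2 / τ) (-1 / τ) = 2 * (1 + ∑' n, g (n + 1)) := by
      rw [← hsum.tsum_eq, tsum_mul_left, hsg.tsum_eq_zero_add]
      simp [hg]
    have hfun := jacobiTheta₂_functional_equation (1 / 2) τ
    have hmain := series_mul_jacobiTheta₂ hτ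
    have e1 : (Real.pi : ℂ) * Complex.I * τ = -Real.pi * s := by
      rw [hτ_def]; ring_nf; simp
    have e2 : -Complex.I * τ = s := by
      rw [hτ_def, ← mul_assoc]; simp
    have e3 : -(Real.pi : ℂ) * Complex.I * (1 / 2) ^ 2 / τ = -(Real.pi / (4 * s)) := by
      rw [hτ_def]; field_simp; norm_num
    rw [e2, e3, hE] at hfun
    rw [e1, hfun, Complex.exp_neg] at hmain
    have h0 : s ^ (1 / 2 : ℂ) ≠ 0 := by
      rw [Ne, Complex.cpow_eq_zero_iff]; simp [hs0]
    have h1 := Complex.exp_ne_zero (Real.pi / (4 * s))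
    generalize series (Complex.exp (-Real.pi * s)) = G at *
    generalize Complex.exp (Real.pi / (4 * s)) = u at *
    field_simp at hmain
    linear_combination hmain

/-! ### The integrand of the Cauchy integral -/

lemma norm_exp_sub_exp_le {a b : ℂ} {M : ℝ} (ha : a.re ≤ M) (hb : b.re ≤ M) :
    ‖Complex.exp a - Complex.exp b‖ ≤ Real.exp M * ‖a - b‖ := by
  have hconv : Convex ℝ {z : ℂ | z.re ≤ M} := convex_halfSpace_re_le M
  refine hconv.norm_image_sub_le_of_norm_hasDerivWithin_le
    (fun z _ => (Complex.hasDerivAt_exp z).hasDerivWithinAt) (fun z hz => ?_) hb ha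
  rw [Complex.norm_exp]
  exact Real.exp_le_exp.2 hz

/-- A convenient form of the bound in `exists_series_exp_mul_eq`, valid for `|Im s| ≤ Re s = x`,
where `Re (1 / s) ≥ 1 / (2 x)`. -/
lemma exp_div_one_sub_exp_le {x c : ℝ} (hx : 0 < x) (hc : 1 / (2 * x) ≤ c) :
    Real.exp (-2 * Real.pi * c) / (1 - Real.exp (-2 * Real.pi * c)) ≤ x := by
  have hpi := Real.pi_gt_three
  have hc0 : 0 < c := lt_of_lt_of_le (by positivity) hc
  have h1 : Real.pi / x + 1 ≤ Real.exp (2 * Real.pi * c) := by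
    refine le_trans ?_ (Real.add_one_le_exp _)
    have : 2 * Real.pi * (1 / (2 * x)) ≤ 2 * Real.pi * c := by gcongr
    have e : 2 * Real.pi * (1 / (2 * x)) = Real.pi / x := by field_simp
    linarith
  have e : -2 * Real.pi * c = -(2 * Real.pi * c) := by ring
  have hpx : 0 < Real.pi / x := by positivity
  have h2 : 0 < Real.exp (2 * Real.pi * c) - 1 := by linarith
  rw [e, Real.exp_neg]
  have e2 : (Real.exp (2 * Real.pi * c))⁻¹ / (1 - (Real.exp (2 * Real.pi * c))⁻¹) =
      1 / (Real.exp (2 * Real.pi * c) - 1) := by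
    have := Real.exp_ne_zero (2 * Real.pi * c)
    have h3 := h2.ne'
    have h4 : 1 - (Real.exp (2 * Real.pi * c))⁻¹ ≠ 0 := by
      intro h
      apply h3
      field_simp at h
      linarith
    field_simp
  rw [e2, div_le_iff₀ h2]
  have : x * (Real.pi / x) ≤ x * (Real.exp (2 * Real.pi * c) - 1) := by
    gcongr; linarith
  rw [mul_div_cancel₀ _ hx.ne'] at this
  linarith

lemma one_half_le_norm_one_add {E : ℂ} (hE : ‖E‖ ≤ 1 / 2) : 1 / 2 ≤ ‖1 + E‖ := by
  have := norm_sub_norm_le (1 : ℂ) (-E)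
  rw [sub_neg_eq_add, norm_neg, norm_one] at this
  linarith

/-- The size of the generating function on the positive real axis, up to a factor `2`. -/
lemma series_exp_le {x : ℝ} (hx : 0 < x) (hx' : x ≤ 1 / 2) :
    series (Real.exp (-Real.pi * x)) ≤ √x * Real.exp (Real.pi / (4 * x)) := by
  obtain ⟨E, hE, h⟩ := exists_series_exp_mul_eq (s := (x : ℂ)) (by simpa using hx)
  have hre : ((x : ℂ)⁻¹).re = x⁻¹ := by rw [← Complex.ofReal_inv, Complex.ofReal_re]
  rw [hre] at hE
  have hE' : ‖E‖ ≤ 1 / 2 := (hE.trans (exp_div_one_sub_exp_le hx (by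
    rw [← one_div]; gcongr; linarith))).trans hx'
  have hn := congrArg norm h
  have e1 : Complex.exp (-Real.pi * x) = (Real.exp (-Real.pi * x) : ℝ) := by push_cast; rfl
  have e2 : Complex.exp (Real.pi / (4 * x)) = (Real.exp (Real.pi / (4 * x)) : ℝ) := by
    push_cast; rfl
  have e3 : ((x : ℂ) ^ (1 / 2 : ℂ)) = (√x : ℝ) := by
    rw [Real.sqrt_eq_rpow, Complex.ofReal_cpow hx.le]; norm_num
  rw [e1, e2, e3, series_ofReal, norm_mul, norm_mul, norm_mul, Complex.norm_real,
    Complex.norm_real, Complex.norm_real, Real.norm_of_nonneg (Real.sqrt_nonneg _),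
    Real.norm_of_nonneg (Real.exp_pos _).le, Complex.norm_ofNat] at hn
  rw [← hn]
  have h1 := one_half_le_norm_one_add hE'
  have h2 := le_abs_self (series (Real.exp (-Real.pi * x)) : ℝ)
  rw [Real.norm_eq_abs]
  nlinarith [abs_nonneg (series (Real.exp (-Real.pi * x)) : ℝ)]

/-- The integrand of the Cauchy integral for `p̄(n)` on the circle of radius `exp (-π x)`, in the
variable `t` with `q = exp (-π x (1 + t i))`, for `x = 1 / (2 √n)`. -/
noncomputable def integrand (x t : ℝ) : ℂ :=
  series (Complex.exp (-Real.pi * (x * (1 + t * Complex.I)))) *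
    Complex.exp ((Real.pi / (4 * x) : ℝ) * (1 + t * Complex.I))

/-- The Gaussian that approximates `integrand x` near `t = 0`. -/
noncomputable def gaussian (x t : ℝ) : ℝ :=
  √x / 2 * Real.exp (Real.pi / (2 * x)) * Real.exp (-(Real.pi / (4 * x)) * t ^ 2)

/-- Writing `w = 1 + t i` and `A = π / (4 x)`, the exponents `A w` and `A / w` of the integrand add up
to `2 A - A t ^ 2 / w`. Replacing `√s`, the relative error of the modular transformation and
`exp (-A t ^ 2 / w)` by `√x`, `1` and `exp (-A t ^ 2)` costs `O(|t|)`, `O(x)` and `O(A |t| ^ 3)`, and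
the cubic term is `O(|t|)` after weakening the Gaussian. -/
lemma norm_integrand_sub_gaussian_le {x t : ℝ} (hx : 0 < x) (hx' : x ≤ 1 / 2) (ht : |t| ≤ 1) :
    ‖integrand x t - gaussian x t‖ ≤ √x * Real.exp (Real.pi / (2 * x)) *
      (5 * (x + |t|) * Real.exp (-(Real.pi / (16 * x)) * t ^ 2)) := by
  set A : ℝ := Real.pi / (4 * x) with hA
  have hA0 : 0 < A := by positivity
  set w : ℂ := 1 + t * Complex.I with hw
  have hwre : w.re = 1 := by simp [hw]
  have hwim : w.im = t := by simp [hw]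
  have ht2 : t ^ 2 ≤ 1 := by rw [← sq_abs]; exact pow_le_one₀ (abs_nonneg t) ht
  have hnw : Complex.normSq w = 1 + t ^ 2 := by rw [Complex.normSq_apply, hwre, hwim]; ring
  have hw0 : w ≠ 0 := by intro h; rw [h] at hwre; simp at hwre
  have hw1 : 1 ≤ ‖w‖ := by
    have := Complex.abs_re_le_norm w
    rwa [hwre, abs_one] at this
  have hw2 : ‖w‖ ≤ 2 := by
    refine (norm_add_le _ _).trans ?_
    rw [norm_mul, Complex.norm_I, Complex.norm_real, norm_one, Real.norm_eq_abs]
    linarith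
  set s : ℂ := x * w with hs
  have hx0 : (x : ℂ) ≠ 0 := by exact_mod_cast hx.ne'
  have hs0 : s ≠ 0 := mul_ne_zero hx0 hw0
  have hsre : 0 < s.re := by rw [hs, Complex.re_ofReal_mul, hwre]; linarith
  have hwinv : (w⁻¹).re = 1 / (1 + t ^ 2) := by rw [Complex.inv_re, hnw, hwre]
  have hhalf : 1 / 2 ≤ 1 / (1 + t ^ 2) := by gcongr; linarith
  have hsinv : 1 / (2 * x) ≤ (s⁻¹).re := by
    rw [hs, mul_inv, ← Complex.ofReal_inv, Complex.re_ofReal_mul, hwinv]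
    have : x⁻¹ * (1 / 2) ≤ x⁻¹ * (1 / (1 + t ^ 2)) := by gcongr
    refine le_trans (le_of_eq ?_) this
    field_simp
  obtain ⟨E, hE, hmain⟩ := exists_series_exp_mul_eq hsre
  replace hE : ‖E‖ ≤ x := hE.trans (exp_div_one_sub_exp_le hx hsinv)
  have hE1 := one_half_le_norm_one_add (hE.trans hx')
  have hE0 : 1 + E ≠ 0 := by rw [← norm_pos_iff]; linarith
  set u : ℂ := s ^ (1 / 2 : ℂ) with hu
  have hu2 : u * u = s := by
    rw [← sq, hu, ← Complex.cpow_nat_mul]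
    norm_num
  have hure : 0 ≤ u.re := by
    have := Complex.abs_arg_lt_pi_div_two_iff.2 (Or.inl hsre)
    rw [hu, Complex.cpow_def_of_ne_zero hs0, Complex.exp_re]
    refine mul_nonneg (Real.exp_pos _).le (Real.cos_nonneg_of_mem_Icc ?_)
    have e : (Complex.log s * (1 / 2)).im = s.arg / 2 := by
      rw [show Complex.log s * (1 / 2) = ((1 / 2 : ℝ) : ℂ) * Complex.log s by push_cast; ring,
        Complex.im_ofReal_mul, Complex.log_im]
      ring
    rw [e]
    rw [abs_lt] at this
    have := Real.pi_pos
    constructor <;> linarith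
  have hsx : 0 < √x := Real.sqrt_pos.2 hx
  have hsx2 : √x * √x = x := Real.mul_self_sqrt hx.le
  have hunorm : ‖u‖ ≤ 2 * √x := by
    have h1 : ‖u‖ * ‖u‖ ≤ 2 * x := by
      rw [← norm_mul, hu2, hs, norm_mul, Complex.norm_real, Real.norm_of_nonneg hx.le]
      nlinarith
    nlinarith [norm_nonneg u]
  -- `u - √x = (s - x) / (u + √x)`, and `Re u ≥ 0` bounds the denominator below by `√x`
  have husub : ‖u - (√x : ℝ)‖ ≤ √x * |t| := by
    have h1 : ‖u - (√x : ℝ)‖ * ‖u + (√x : ℝ)‖ = x * |t| := by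
      rw [← norm_mul]
      have : (u - (√x : ℝ)) * (u + (√x : ℝ)) = x * (t * Complex.I) := by
        have h2 : ((√x : ℝ) : ℂ) * (√x : ℝ) = x := by exact_mod_cast hsx2
        linear_combination hu2 - h2 + hs + (x : ℂ) * hw
      rw [this, norm_mul, norm_mul, Complex.norm_I, Complex.norm_real, Complex.norm_real,
        Real.norm_of_nonneg hx.le, Real.norm_eq_abs, mul_one]
    have h2 : √x ≤ ‖u + (√x : ℝ)‖ := by
      refine le_trans ?_ (Complex.re_le_norm _)
      simp [hure]
    have h3 : ‖u - (√x : ℝ)‖ * √x ≤ √x * |t| * √x := by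
      calc _ ≤ ‖u - (√x : ℝ)‖ * ‖u + (√x : ℝ)‖ := by gcongr
        _ = √x * |t| * √x := by rw [h1, mul_right_comm, hsx2]
    exact le_of_mul_le_mul_right h3 hsx
  set z : ℂ := -(A * t ^ 2 * w⁻¹) with hz
  set D : ℂ := (1 + E)⁻¹ with hD
  have hD1 : ‖D - 1‖ ≤ 2 * x := by
    have : D - 1 = -E / (1 + E) := by rw [hD]; field_simp; ring
    rw [this, norm_div, norm_neg, div_le_iff₀ (by linarith)]
    nlinarith
  have hzre : z.re ≤ -(A * t ^ 2 / 2) := by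
    have : z.re = -(A * t ^ 2 * (1 / (1 + t ^ 2))) := by
      rw [hz, Complex.neg_re, ← hwinv, ← Complex.re_ofReal_mul]
      push_cast
      rfl
    rw [this]
    have : A * t ^ 2 * (1 / 2) ≤ A * t ^ 2 * (1 / (1 + t ^ 2)) := by gcongr
    linarith
  have hexpz : ‖Complex.exp z‖ ≤ Real.exp (-(A * t ^ 2 / 2)) := by
    rw [Complex.norm_exp]; exact Real.exp_le_exp.2 hzre
  have hexpsub : ‖Complex.exp z - (Real.exp (-A * t ^ 2) : ℝ)‖ ≤
      Real.exp (-(A * t ^ 2 / 2)) * (A * t ^ 2 * |t|) := by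
    rw [Complex.ofReal_exp]
    refine (norm_exp_sub_exp_le hzre (b := ((-A * t ^ 2 : ℝ) : ℂ)) ?_).trans ?_
    · rw [Complex.ofReal_re]
      have : 0 ≤ A * t ^ 2 := by positivity
      linarith
    · gcongr
      have : z - ((-A * t ^ 2 : ℝ) : ℂ) = (A * t ^ 2 : ℝ) * (t * Complex.I) * w⁻¹ := by
        have h1 : w⁻¹ * w = 1 := inv_mul_cancel₀ hw0
        rw [hz]
        push_cast
        linear_combination (-(A : ℂ) * t ^ 2) * h1 + (A : ℂ) * t ^ 2 * w⁻¹ * hw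
      rw [this, norm_mul, norm_mul, norm_mul, Complex.norm_I, Complex.norm_real, Complex.norm_real,
        norm_inv, Real.norm_of_nonneg (by positivity), Real.norm_eq_abs, mul_one]
      have h1 : ‖w‖⁻¹ ≤ 1 := inv_le_one_of_one_le₀ hw1
      exact mul_le_of_le_one_right (by positivity) h1
  have hint : integrand x t =
      Real.exp (Real.pi / (2 * x)) / 2 * (u * D * Complex.exp z) := by
    have h1 : Complex.exp (Real.pi / (4 * s)) * Complex.exp (A * w) =
        Complex.exp (Real.pi / (2 * x)) * Complex.exp z := by
      rw [← Complex.exp_add, ← Complex.exp_add]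
      congr 1
      have hwt : (w - 1) ^ 2 = -(t : ℂ) ^ 2 := by
        rw [hw]; ring_nf; simp
      rw [hz, hs, hA]
      push_cast
      field_simp
      linear_combination 2 * hwt
    have hD' : (1 + E) * D = 1 := mul_inv_cancel₀ hE0
    rw [integrand, ← hw, ← hs, ← hA]
    push_cast
    linear_combination (D / 2 * Complex.exp (A * w)) * hmain + (u * D / 2) * h1
      - (series (Complex.exp (-Real.pi * s)) * Complex.exp (A * w)) * hD'
  have hdiff : integrand x t - gaussian x t = (Real.exp (Real.pi / (2 * x)) / 2 : ℝ) *
      (u * (D - 1) * Complex.exp z + (u - (√x : ℝ)) * Complex.exp z +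
        (√x : ℝ) * (Complex.exp z - (Real.exp (-A * t ^ 2) : ℝ))) := by
    rw [hint, gaussian, ← hA]
    push_cast
    ring
  set V := Real.exp (-(Real.pi / (16 * x)) * t ^ 2) with hV
  have hV2 : Real.exp (-(A * t ^ 2 / 2)) = V * Real.exp (-(A * t ^ 2 / 4)) := by
    rw [hV, ← Real.exp_add, hA]
    congr 1
    field_simp
    ring
  have hv0 : 0 ≤ A * t ^ 2 := by positivity
  have hle1 : Real.exp (-(A * t ^ 2 / 4)) ≤ 1 := Real.exp_le_one_iff.2 (by linarith)
  -- half of the Gaussian decay pays for the factor `A * t ^ 2`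
  have hle4 : Real.exp (-(A * t ^ 2 / 4)) * (A * t ^ 2) ≤ 4 := by
    have h1 := Real.add_one_le_exp (A * t ^ 2 / 4)
    rw [Real.exp_neg, inv_mul_le_iff₀ (Real.exp_pos _)]
    linarith
  have hV0 : 0 < V := Real.exp_pos _
  have hsumle : ‖u * (D - 1) * Complex.exp z + (u - (√x : ℝ)) * Complex.exp z +
        (√x : ℝ) * (Complex.exp z - (Real.exp (-A * t ^ 2) : ℝ))‖ ≤
      2 * √x * (2 * x) * V + √x * |t| * V + √x * (V * 4 * |t|) := by
    have hexpz' : ‖Complex.exp z‖ ≤ V := hexpz.trans (by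
      rw [hV2]; exact mul_le_of_le_one_right hV0.le hle1)
    have hexpsub' : ‖Complex.exp z - (Real.exp (-A * t ^ 2) : ℝ)‖ ≤ V * 4 * |t| := by
      refine hexpsub.trans ?_
      rw [hV2]
      calc V * Real.exp (-(A * t ^ 2 / 4)) * (A * t ^ 2 * |t|)
          = V * (Real.exp (-(A * t ^ 2 / 4)) * (A * t ^ 2)) * |t| := by ring
        _ ≤ _ := by gcongr
    refine (norm_add₃_le ..).trans ?_
    rw [norm_mul, norm_mul, norm_mul, norm_mul, Complex.norm_real, Real.norm_of_nonneg hsx.le]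
    gcongr
  rw [hdiff, norm_mul, Complex.norm_real, Real.norm_of_nonneg (by positivity)]
  calc _ ≤ Real.exp (Real.pi / (2 * x)) / 2 *
        (2 * √x * (2 * x) * V + √x * |t| * V + √x * (V * 4 * |t|)) := by gcongr
    _ = √x * Real.exp (Real.pi / (2 * x)) * ((2 * x + 5 / 2 * |t|) * V) := by ring
    _ ≤ _ := by
      gcongr
      linarith [abs_nonneg t]

/-- Away from `t = 0` the integrand is exponentially small compared with its maximum, by
`norm_series_le`: for `q = exp (-π x (1 + t i))` with `1 ≤ |t| ≤ 1 / x` the distance `|1 - q|` exceeds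
`1 - |q|` by at least a factor `21 / 20`. -/
lemma norm_integrand_le {x t : ℝ} (hx : 0 < x) (hx' : x ≤ 1 / 8) (ht : 1 ≤ |t|)
    (ht' : |t| ≤ x⁻¹) :
    ‖integrand x t‖ ≤ √x * Real.exp (Real.pi / (2 * x)) * Real.exp (-(168 * x)⁻¹) := by
  have hpi := Real.pi_pos
  set q := Complex.exp (-Real.pi * (x * (1 + t * Complex.I))) with hq
  set r := Real.exp (-Real.pi * x) with hr
  have e0 : -(Real.pi : ℂ) * (x * (1 + t * Complex.I)) =
      ((-Real.pi * x : ℝ) : ℂ) + ((-(Real.pi * x * t) : ℝ) : ℂ) * Complex.I := by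
    push_cast; ring
  have hqre : q.re = r * Real.cos (Real.pi * x * t) := by
    rw [hq, e0, Complex.exp_re]
    simp [hr]
  have hqnorm : ‖q‖ = r := by
    rw [hq, e0, Complex.norm_exp]
    simp [hr]
  have hr0 : 0 < r := Real.exp_pos _
  have hr1 : r < 1 := by rw [hr, Real.exp_lt_one_iff]; nlinarith
  have hpx := mul_pos hpi hx
  have hrlow : 1 - 4 * x ≤ r := by
    have := Real.add_one_le_exp (-Real.pi * x)
    nlinarith [Real.pi_lt_four]
  have hrhalf : 1 / 2 ≤ r := by linarith
  have hxt : x * |t| ≤ 1 := by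
    calc x * |t| ≤ x * x⁻¹ := by gcongr
      _ = 1 := mul_inv_cancel₀ hx.ne'
  have hcos : Real.cos (Real.pi * x * t) ≤ 1 - 2 * x ^ 2 := by
    have habs : |Real.pi * x * t| ≤ Real.pi := by
      rw [abs_mul, abs_of_pos hpx]
      nlinarith
    refine (Real.cos_le_one_sub_mul_cos_sq habs).trans ?_
    have e : 2 / Real.pi ^ 2 * (Real.pi * x * t) ^ 2 = 2 * x ^ 2 * t ^ 2 := by field_simp
    have ht2 : 1 ≤ t ^ 2 := by rw [← sq_abs]; exact one_le_pow₀ ht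
    rw [e]
    nlinarith [sq_nonneg x]
  have hsq : ‖1 - q‖ ^ 2 = 1 - 2 * q.re + r ^ 2 := by
    rw [← hqnorm, Complex.sq_norm, Complex.sq_norm, Complex.normSq_apply, Complex.normSq_apply]
    simp
    ring
  -- `|1 - q| ^ 2 = (1 - r) ^ 2 + 2 r (1 - cos (π x t)) ≥ (1 - r) ^ 2 + 2 x ^ 2`, and `1 - r ≤ 4 x`
  have hlow : 21 / 20 * (1 - r) ≤ ‖1 - q‖ := by
    refine abs_le_of_sq_le_sq' ?_ (norm_nonneg _) |>.2
    rw [hsq, hqre]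
    have h1 : r * Real.cos (Real.pi * x * t) ≤ r * (1 - 2 * x ^ 2) := by gcongr
    have h2 : (1 - r) ^ 2 ≤ (4 * x) ^ 2 := by
      apply pow_le_pow_left₀ <;> linarith
    have h3 : 1 / 2 * x ^ 2 ≤ r * x ^ 2 := by gcongr
    nlinarith
  have h1q : 0 < ‖1 - q‖ := lt_of_lt_of_le (by linarith) hlow
  have hgain : (168 * x)⁻¹ ≤ ‖q‖ / (1 - ‖q‖) - (q / (1 - q)).re := by
    have h1 : (q / (1 - q)).re ≤ r / (21 / 20 * (1 - r)) := by
      refine (Complex.re_le_norm _).trans ?_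
      rw [norm_div, hqnorm]
      have : 0 < 1 - r := by linarith
      gcongr
    rw [hqnorm]
    have h2 : r / (1 - r) - r / (21 / 20 * (1 - r)) = r / (21 * (1 - r)) := by
      have : 1 - r ≠ 0 := by linarith
      field_simp
      ring
    have h3 : (168 * x)⁻¹ ≤ r / (21 * (1 - r)) := by
      rw [inv_eq_one_div, div_le_div_iff₀ (by positivity) (by linarith)]
      nlinarith
    linarith
  have hq1 : ‖q‖ < 1 := by rwa [hqnorm]
  have hser : ‖series q‖ ≤ √x * Real.exp (Real.pi / (4 * x)) * Real.exp (-(168 * x)⁻¹) := by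
    refine (norm_series_le hq1).trans ?_
    rw [hqnorm] at *
    have := series_exp_le hx (by linarith)
    gcongr
  have hexp : ‖Complex.exp ((Real.pi / (4 * x) : ℝ) * (1 + t * Complex.I))‖ =
      Real.exp (Real.pi / (4 * x)) := by
    rw [Complex.norm_exp, Complex.re_ofReal_mul]
    simp
  have e2 : Real.exp (Real.pi / (2 * x)) =
      Real.exp (Real.pi / (4 * x)) * Real.exp (Real.pi / (4 * x)) := by
    rw [← Real.exp_add]
    congr 1
    field_simp
    norm_num
  rw [integrand, norm_mul, hexp, e2]
  calc _ ≤ √x * Real.exp (Real.pi / (4 * x)) * Real.exp (-(168 * x)⁻¹) *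
        Real.exp (Real.pi / (4 * x)) := by gcongr
    _ = _ := by ring

/-! ### The Cauchy integral -/

/-- The term of index `m` in the expansion of `integrand x t`, when `n = 1 / (4 x ^ 2)`. -/
noncomputable def integrandTerm (x : ℝ) (n m : ℕ) (t : ℝ) : ℂ :=
  ((overpartitionCount (m : ℤ) * Real.exp (Real.pi * x * (n - m)) : ℝ) : ℂ) *
    Complex.exp ((Real.pi * x * (n - m) * Complex.I) * t)

lemma norm_integrandTerm (x : ℝ) (n m : ℕ) (t : ℝ) :
    ‖integrandTerm x n m t‖ =
      overpartitionCount (m : ℤ) * Real.exp (Real.pi * x * (n - m)) := by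
  have e : (Real.pi * x * (n - m) * Complex.I : ℂ) * t =
      ((Real.pi * x * (n - m) * t : ℝ) : ℂ) * Complex.I := by push_cast; ring
  rw [integrandTerm, norm_mul, e, Complex.norm_exp_ofReal_mul_I, Complex.norm_real,
    Real.norm_of_nonneg (by positivity), mul_one]

lemma summable_norm_integrandTerm {x : ℝ} (hx : 0 < x) (n : ℕ) :
    Summable fun m : ℕ =>
      (overpartitionCount (m : ℤ) : ℝ) * Real.exp (Real.pi * x * (n - m)) := by
  have hr : Real.exp (-(Real.pi * x)) < 1 := by
    rw [Real.exp_lt_one_iff]; have := mul_pos Real.pi_pos hx; linarith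
  refine ((summable_series_real (Real.exp_pos _).le hr).mul_right
    (Real.exp (Real.pi * x * n))).congr fun m => ?_
  rw [← Real.exp_nat_mul, mul_assoc, ← Real.exp_add]
  congr 2
  ring

lemma integrand_eq_tsum {x : ℝ} (hx : 0 < x) {n : ℕ} (hn : (n : ℝ) * (4 * x ^ 2) = 1) (t : ℝ) :
    integrand x t = ∑' m, integrandTerm x n m t := by
  have hA : Real.pi / (4 * x) = Real.pi * x * n := by
    field_simp
    linarith
  rw [integrand, series, ← tsum_mul_right, hA]
  refine tsum_congr fun m => ?_
  have h : Complex.exp (-Real.pi * (x * (1 + t * Complex.I))) ^ m *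
      Complex.exp ((Real.pi * x * n : ℝ) * (1 + t * Complex.I)) =
      Complex.exp (Real.pi * x * (n - m)) *
        Complex.exp ((Real.pi * x * (n - m) * Complex.I) * t) := by
    rw [← Complex.exp_nat_mul, ← Complex.exp_add, ← Complex.exp_add]
    congr 1
    push_cast
    ring
  rw [integrandTerm, mul_assoc]
  push_cast at h ⊢
  rw [h]
  ring_nf

lemma continuous_integrandTerm (x : ℝ) (n m : ℕ) : Continuous (integrandTerm x n m) := by
  unfold integrandTerm
  fun_prop

lemma continuous_integrand {x : ℝ} (hx : 0 < x) {n : ℕ} (hn : (n : ℝ) * (4 * x ^ 2) = 1) :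
    Continuous (integrand x) := by
  rw [funext (integrand_eq_tsum hx hn)]
  exact continuous_tsum (continuous_integrandTerm x n) (summable_norm_integrandTerm hx n)
    fun m t => (norm_integrandTerm x n m t).le

lemma integral_integrandTerm {x : ℝ} (hx : 0 < x) (n m : ℕ) :
    ∫ t in (-x⁻¹)..x⁻¹, integrandTerm x n m t =
      if m = n then (2 / x : ℝ) * (overpartitionCount (n : ℤ) : ℂ) else 0 := by
  have hx0 : (x : ℂ) ≠ 0 := by exact_mod_cast hx.ne'
  simp only [integrandTerm]
  rw [intervalIntegral.integral_const_mul]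
  split_ifs with h
  · subst h
    simp
    ring
  · have hc : (Real.pi * x * (n - m) * Complex.I : ℂ) ≠ 0 := by
      have : (n : ℂ) - m ≠ 0 := sub_ne_zero.2 (by exact_mod_cast Ne.symm h)
      have hpi : (Real.pi : ℂ) ≠ 0 := by exact_mod_cast Real.pi_ne_zero
      simp [this, hx0]
    rw [integral_exp_mul_complex hc]
    have : Complex.exp ((Real.pi * x * (n - m) * Complex.I : ℂ) * (x⁻¹ : ℝ)) =
        Complex.exp ((Real.pi * x * (n - m) * Complex.I : ℂ) * (-x⁻¹ : ℝ)) := by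
      rw [Complex.exp_eq_exp_iff_exists_int]
      refine ⟨(n : ℤ) - m, ?_⟩
      push_cast
      field_simp
      ring
    rw [this, sub_self, zero_div, mul_zero]

/-- Cauchy's formula on the circle of radius `exp (-π x)`. -/
lemma integral_integrand {x : ℝ} (hx : 0 < x) {n : ℕ} (hn : (n : ℝ) * (4 * x ^ 2) = 1) :
    ∫ t in (-x⁻¹)..x⁻¹, integrand x t = (2 / x : ℝ) * (overpartitionCount (n : ℤ) : ℂ) := by
  have h := intervalIntegral.hasSum_integral_of_dominated_convergence
    (μ := volume) (a := -x⁻¹) (b := x⁻¹) (F := fun m => integrandTerm x n m) (f := integrand x)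
    (fun m _ => (overpartitionCount (m : ℤ) : ℝ) * Real.exp (Real.pi * x * (n - m)))
    (fun m => (continuous_integrandTerm x n m).aestronglyMeasurable)
    (fun m => Eventually.of_forall fun t _ => (norm_integrandTerm x n m t).le)
    (Eventually.of_forall fun t _ => summable_norm_integrandTerm hx n)
    intervalIntegrable_const
    (Eventually.of_forall fun t _ => by
      rw [integrand_eq_tsum hx hn]
      refine (Summable.of_norm ?_).hasSum
      simpa only [norm_integrandTerm] using summable_norm_integrandTerm hx n)
  simp only [integral_integrandTerm hx] at h
  exact h.unique (hasSum_ite_eq n _)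

/-! ### The asymptotic formula for overpartitions -/

lemma integral_gaussian_eq {x : ℝ} (hx : 0 < x) :
    ∫ t, gaussian x t = x * Real.exp (Real.pi / (2 * x)) := by
  simp only [gaussian]
  rw [integral_const_mul, integral_gaussian]
  have e : Real.pi / (Real.pi / (4 * x)) = 2 ^ 2 * x := by field_simp; norm_num
  rw [e, Real.sqrt_mul (by norm_num), Real.sqrt_sq (by norm_num)]
  have := Real.mul_self_sqrt hx.le
  linear_combination Real.exp (Real.pi / (2 * x)) * this

lemma integrable_gaussian {x : ℝ} (hx : 0 < x) : Integrable (gaussian x) := by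
  unfold gaussian
  exact (integrable_exp_neg_mul_sq (by positivity)).const_mul _

lemma integrable_abs_mul_exp {b : ℝ} (hb : 0 < b) :
    Integrable fun t : ℝ => |t| * Real.exp (-b * t ^ 2) := by
  refine (integrable_mul_exp_neg_mul_sq hb).norm.congr (Eventually.of_forall fun t => ?_)
  simp

lemma integral_abs_mul_exp {b : ℝ} (hb : 0 < b) :
    ∫ t : ℝ, |t| * Real.exp (-b * t ^ 2) = b⁻¹ := by
  have h1 := integral_comp_abs (f := fun t : ℝ => t * Real.exp (-b * t ^ 2))
  simp only [sq_abs] at h1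
  have h2 := integral_mul_cexp_neg_mul_sq (b := (b : ℂ)) (by simpa using hb)
  have h3 : (∫ t : ℝ in Set.Ioi 0, t * Real.exp (-b * t ^ 2)) = (2 * b)⁻¹ := by
    rw [← Complex.ofReal_inj, ← integral_complex_ofReal]
    push_cast at h2 ⊢
    exact h2
  rw [h1, h3]
  field_simp

/-- The majorant of the error `integrand x t - gaussian x t`, up to the factor
`√x * exp (π / (2 x))`. -/
noncomputable def errorBound (x t : ℝ) : ℝ :=
  5 * (x * Real.exp (-(Real.pi / (16 * x)) * t ^ 2) +
      |t| * Real.exp (-(Real.pi / (16 * x)) * t ^ 2)) +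
    (Set.Ioc (-x⁻¹) x⁻¹).indicator (fun _ => Real.exp (-(168 * x)⁻¹)) t

lemma integrable_errorBound {x : ℝ} (hx : 0 < x) : Integrable (errorBound x) := by
  have hb : 0 < Real.pi / (16 * x) := by positivity
  refine ((((integrable_exp_neg_mul_sq hb).const_mul x).add
    (integrable_abs_mul_exp hb)).const_mul 5).add ?_
  rw [integrable_indicator_iff measurableSet_Ioc]
  exact integrableOn_const (by simp)

/-- The three terms contribute at most `20 x`, `80 x` and `112896 x`, where `112896 = 4 * 168 ^ 2`. -/
lemma integral_errorBound_le {x : ℝ} (hx : 0 < x) (hx' : x ≤ 1 / 8) :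
    ∫ t, errorBound x t ≤ 113000 * x := by
  have hb : 0 < Real.pi / (16 * x) := by positivity
  have hind : Integrable
      ((Set.Ioc (-x⁻¹) x⁻¹).indicator (fun _ : ℝ => Real.exp (-(168 * x)⁻¹))) := by
    rw [integrable_indicator_iff measurableSet_Ioc]
    exact integrableOn_const (by simp)
  have hmain : Integrable fun t : ℝ => 5 * (x * Real.exp (-(Real.pi / (16 * x)) * t ^ 2) +
      |t| * Real.exp (-(Real.pi / (16 * x)) * t ^ 2)) :=
    (((integrable_exp_neg_mul_sq hb).const_mul x).add (integrable_abs_mul_exp hb)).const_mul 5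
  simp only [errorBound]
  rw [integral_add hmain hind, integral_const_mul,
    integral_add ((integrable_exp_neg_mul_sq hb).const_mul x) (integrable_abs_mul_exp hb),
    integral_const_mul, integral_gaussian, integral_abs_mul_exp hb,
    integral_indicator measurableSet_Ioc, setIntegral_const]
  have e1 : Real.pi / (Real.pi / (16 * x)) = 16 * x := by field_simp
  have h1 : √(16 * x) ≤ 2 := by
    rw [Real.sqrt_le_left (by norm_num)]; linarith
  have h2 : (Real.pi / (16 * x))⁻¹ ≤ 16 * x := by
    rw [inv_div, div_le_iff₀ Real.pi_pos]
    nlinarith [Real.pi_gt_three]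
  have h3 : volume.real (Set.Ioc (-x⁻¹) x⁻¹) = 2 * x⁻¹ := by
    rw [Real.volume_real_Ioc_of_le (by have := inv_pos.2 hx; linarith)]; ring
  have h4 : 2 * x⁻¹ * Real.exp (-(168 * x)⁻¹) ≤ 112896 * x := by
    have h := Real.quadratic_le_exp_of_nonneg (x := (168 * x)⁻¹) (by positivity)
    have hpos : 0 < (168 * x)⁻¹ := by positivity
    rw [Real.exp_neg, ← div_eq_mul_inv, div_le_iff₀ (Real.exp_pos _)]
    calc 2 * x⁻¹ = 112896 * x * ((168 * x)⁻¹ ^ 2 / 2) := by field_simp; norm_num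
      _ ≤ _ := by gcongr; linarith
  rw [e1, h3, smul_eq_mul]
  nlinarith

lemma norm_indicator_integrand_sub_gaussian_le {x : ℝ} (hx : 0 < x) (hx' : x ≤ 1 / 8) (t : ℝ) :
    ‖(Set.Ioc (-x⁻¹) x⁻¹).indicator (integrand x) t - gaussian x t‖ ≤
      √x * Real.exp (Real.pi / (2 * x)) * errorBound x t := by
  have hx8 : 8 ≤ x⁻¹ := by
    rw [le_inv_comm₀ (by norm_num) hx]; linarith
  set V := Real.exp (-(Real.pi / (16 * x)) * t ^ 2) with hV
  have hV0 : 0 < V := Real.exp_pos _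
  rcases le_or_gt |t| 1 with ht | ht
  · have hmem : t ∈ Set.Ioc (-x⁻¹) x⁻¹ := by
      rw [abs_le] at ht; constructor <;> linarith
    rw [Set.indicator_of_mem hmem]
    refine (norm_integrand_sub_gaussian_le hx (by linarith) ht).trans ?_
    rw [errorBound, ← hV, Set.indicator_of_mem hmem]
    gcongr
    have := Real.exp_pos (-(168 * x)⁻¹)
    linarith
  · have hgauss : ‖(gaussian x t : ℂ)‖ ≤ √x * Real.exp (Real.pi / (2 * x)) * (|t| * V) := by
      rw [Complex.norm_real, gaussian, Real.norm_of_nonneg (by positivity)]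
      have h1 : Real.exp (-(Real.pi / (4 * x)) * t ^ 2) ≤ V := by
        rw [hV]
        gcongr
        norm_num
      calc √x / 2 * Real.exp (Real.pi / (2 * x)) * Real.exp (-(Real.pi / (4 * x)) * t ^ 2)
          ≤ √x * Real.exp (Real.pi / (2 * x)) * (1 * V) := by
            rw [one_mul]
            gcongr
            linarith [Real.sqrt_nonneg x]
        _ ≤ _ := by gcongr
    have hpos : 0 ≤ x * V := by positivity
    have hpos' : 0 ≤ |t| * V := by positivity
    by_cases hmem : t ∈ Set.Ioc (-x⁻¹) x⁻¹
    · rw [errorBound, ← hV, Set.indicator_of_mem hmem, Set.indicator_of_mem hmem]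
      have h2 := norm_integrand_le hx hx' ht.le (abs_le.2 ⟨hmem.1.le, hmem.2⟩)
      refine (norm_sub_le _ _).trans ((add_le_add h2 hgauss).trans ?_)
      rw [← mul_add]
      exact mul_le_mul_of_nonneg_left (by linarith) (by positivity)
    · rw [errorBound, ← hV, Set.indicator_of_notMem hmem, Set.indicator_of_notMem hmem, zero_sub,
        norm_neg, add_zero]
      exact hgauss.trans (mul_le_mul_of_nonneg_left (by linarith) (by positivity))

/-- The asymptotic formula in terms of the radius `exp (-π x)`; the hypothesis `hn` says that
`x = 1 / (2 √n)` is the saddle point. -/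
lemma abs_overpartitionCount_sub_le {x : ℝ} (hx : 0 < x) (hx' : x ≤ 1 / 8) {n : ℕ}
    (hn : (n : ℝ) * (4 * x ^ 2) = 1) :
    |(overpartitionCount (n : ℤ) : ℝ) - x ^ 2 / 2 * Real.exp (Real.pi / (2 * x))| ≤
      56500 * (x ^ 2 * √x * Real.exp (Real.pi / (2 * x))) := by
  have hle : -x⁻¹ ≤ x⁻¹ := by have := inv_pos.2 hx; linarith
  have hcont := continuous_integrand hx hn
  have hint : Integrable ((Set.Ioc (-x⁻¹) x⁻¹).indicator (integrand x)) := by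
    rw [integrable_indicator_iff measurableSet_Ioc,
      ← intervalIntegrable_iff_integrableOn_Ioc_of_le hle]
    exact hcont.intervalIntegrable _ _
  have h1 := integral_integrand hx hn
  rw [intervalIntegral.integral_of_le hle, ← integral_indicator measurableSet_Ioc] at h1
  have h2 : ∫ t, (gaussian x t : ℂ) = ((x * Real.exp (Real.pi / (2 * x)) : ℝ) : ℂ) := by
    rw [integral_complex_ofReal, integral_gaussian_eq hx]
  have h3 := integral_sub hint (integrable_gaussian hx).ofReal
  have h4 := norm_integral_le_of_norm_le
    ((integrable_errorBound hx).const_mul (√x * Real.exp (Real.pi / (2 * x))))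
    (Eventually.of_forall (norm_indicator_integrand_sub_gaussian_le hx hx'))
  rw [integral_const_mul] at h4
  have h5 : ∫ t, ((Set.Ioc (-x⁻¹) x⁻¹).indicator (integrand x) t - (gaussian x t : ℂ)) =
      ((2 / x * (overpartitionCount (n : ℤ) - x ^ 2 / 2 * Real.exp (Real.pi / (2 * x))) : ℝ) : ℂ) := by
    refine h3.trans ?_
    rw [h1]
    refine (congrArg _ h2).trans ?_
    push_cast
    have : (x : ℂ) ≠ 0 := by exact_mod_cast hx.ne'
    field_simp
  rw [h5, Complex.norm_real, norm_mul, Real.norm_of_nonneg (by positivity), Real.norm_eq_abs] at h4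
  have h6 := integral_errorBound_le hx hx'
  have h7 : 2 / x * |(overpartitionCount (n : ℤ) : ℝ) - x ^ 2 / 2 * Real.exp (Real.pi / (2 * x))| ≤
      √x * Real.exp (Real.pi / (2 * x)) * (113000 * x) := h4.trans (by gcongr)
  calc |(overpartitionCount (n : ℤ) : ℝ) - x ^ 2 / 2 * Real.exp (Real.pi / (2 * x))|
      = x / 2 * (2 / x *
        |(overpartitionCount (n : ℤ) : ℝ) - x ^ 2 / 2 * Real.exp (Real.pi / (2 * x))|) := by
        field_simp
    _ ≤ x / 2 * (√x * Real.exp (Real.pi / (2 * x)) * (113000 * x)) := by gcongr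
    _ = _ := by ring

/-- The main term `exp (π √n) / (8 n)`. -/
noncomputable def mainTerm (n : ℝ) : ℝ := 1 / 8 * n⁻¹ * Real.exp (Real.pi * √n)

/-- The asymptotic formula for overpartitions with a power saving: the saddle point is
`x = 1 / (2 √n)`. -/
theorem abs_overpartitionCount_sub_mainTerm_le {n : ℕ} (hn : 16 ≤ n) :
    |(overpartitionCount (n : ℤ) : ℝ) - mainTerm n| ≤
      113000 * ((n : ℝ) ^ (-(1 / 4) : ℝ) * mainTerm n) := by
  have hn' : (16 : ℝ) ≤ n := by exact_mod_cast hn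
  have hn0 : (0 : ℝ) < n := by linarith
  have h4 : 4 ≤ √(n : ℝ) := Real.le_sqrt_of_sq_le (by linarith)
  set x : ℝ := (2 * √(n : ℝ))⁻¹ with hx
  have hsq : √(n : ℝ) ^ 2 = n := Real.sq_sqrt hn0.le
  have hs0 : 0 < √(n : ℝ) := by linarith
  have hx0 : 0 < x := by positivity
  have hx1 : x ≤ 1 / 8 := by
    rw [hx, inv_eq_one_div]
    gcongr
    linarith
  have hx2 : x ^ 2 = (4 * n : ℝ)⁻¹ := by
    rw [hx, inv_pow, mul_pow, hsq]; norm_num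
  have hxn : (n : ℝ) * (4 * x ^ 2) = 1 := by rw [hx2]; field_simp
  have hpi : Real.pi / (2 * x) = Real.pi * √n := by rw [hx]; field_simp
  have h := abs_overpartitionCount_sub_le hx0 hx1 hxn
  have hsx : √x ≤ (n : ℝ) ^ (-(1 / 4) : ℝ) := by
    have e : (n : ℝ) ^ (-(1 / 4) : ℝ) = √((√(n : ℝ))⁻¹) := by
      rw [Real.sqrt_inv, Real.sqrt_eq_rpow, Real.sqrt_eq_rpow, ← Real.rpow_mul hn0.le,
        ← Real.rpow_neg hn0.le]
      norm_num
    rw [e, hx]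
    apply Real.sqrt_le_sqrt
    gcongr
    linarith
  rw [hpi, hx2] at h
  have hm : mainTerm n = (4 * n : ℝ)⁻¹ / 2 * Real.exp (Real.pi * √n) := by
    rw [mainTerm, mul_inv]; ring
  rw [hm]
  refine h.trans ?_
  calc 56500 * ((4 * n : ℝ)⁻¹ * √x * Real.exp (Real.pi * √n))
      ≤ 56500 * ((4 * n : ℝ)⁻¹ * (n : ℝ) ^ (-(1 / 4) : ℝ) * Real.exp (Real.pi * √n)) := by gcongr
    _ = _ := by ring

/-! ### Truncated sums -/

lemma mainTerm_nonneg {n : ℝ} (hn : 0 ≤ n) : 0 ≤ mainTerm n := by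
  unfold mainTerm
  positivity

/-- Shifting the argument by `d` changes the main term by a relative error `O(d / √n)`, since
`√n - √(n - d) ≤ d / √n`. -/
lemma abs_mainTerm_sub_mainTerm_le {n d : ℝ} (hn : 1 ≤ n) (hd : 0 ≤ d) (hdn : d ≤ n / 2) :
    |mainTerm (n - d) - mainTerm n| ≤ 4 * (d / √n) * mainTerm n := by
  have hn0 : 0 < n := by linarith
  have hm0 : 0 < n - d := by linarith
  have hs : 0 < √n := Real.sqrt_pos.2 hn0
  have hs' : 0 < √(n - d) := Real.sqrt_pos.2 hm0
  have hsn : √n ^ 2 = n := Real.sq_sqrt hn0.le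
  have hsm : √(n - d) ^ 2 = n - d := Real.sq_sqrt hm0.le
  have hmono : √(n - d) ≤ √n := Real.sqrt_le_sqrt (by linarith)
  have hs1 : 1 ≤ √n := Real.one_le_sqrt.2 hn
  have hdiff : √n - √(n - d) ≤ d / √n := by
    rw [le_div_iff₀ hs]
    nlinarith
  have hfac : mainTerm (n - d) =
      n / (n - d) * Real.exp (-(Real.pi * (√n - √(n - d)))) * mainTerm n := by
    have : Real.exp (Real.pi * √(n - d)) =
        Real.exp (-(Real.pi * (√n - √(n - d)))) * Real.exp (Real.pi * √n) := by
      rw [← Real.exp_add]; congr 1; ring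
    rw [mainTerm, mainTerm, this]
    field_simp
  have hM := mainTerm_nonneg hn0.le
  have hpi := Real.pi_pos
  have hu : Real.pi * (√n - √(n - d)) ≤ 4 * (d / √n) :=
    mul_le_mul Real.pi_lt_four.le hdiff (by linarith) (by norm_num)
  have hlow : 1 - 4 * (d / √n) ≤ n / (n - d) * Real.exp (-(Real.pi * (√n - √(n - d)))) := by
    have h1 := Real.add_one_le_exp (-(Real.pi * (√n - √(n - d))))
    have h2 : 1 ≤ n / (n - d) := by rw [le_div_iff₀ hm0]; linarith
    have h3 := Real.exp_pos (-(Real.pi * (√n - √(n - d))))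
    nlinarith
  have hupp : n / (n - d) * Real.exp (-(Real.pi * (√n - √(n - d)))) ≤ 1 + 4 * (d / √n) := by
    have h1 : Real.exp (-(Real.pi * (√n - √(n - d)))) ≤ 1 := by
      rw [Real.exp_le_one_iff]
      have := mul_nonneg hpi.le (sub_nonneg.2 hmono)
      linarith
    have h2 : n / (n - d) ≤ 1 + 2 * (d / n) := by
      rw [div_le_iff₀ hm0]
      have h3 : d / n * n = d := div_mul_cancel₀ _ hn0.ne'
      have h4 : 0 ≤ d / n := by positivity
      nlinarith
    have h3 : d / n ≤ d / √n := by
      gcongr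
      nlinarith
    have h4 : 0 ≤ d / √n := by positivity
    have h5 : 0 ≤ n / (n - d) := by positivity
    nlinarith
  rw [hfac, abs_le]
  constructor <;> nlinarith

lemma abs_overpartitionCount_sub_sq_sub_mainTerm_le {n k : ℕ} {j : ℤ} (hn : 32 ≤ n) (hk : 1 ≤ k)
    (hkn : (k : ℝ) ^ 2 ≤ n / 2) (hj : j.natAbs ≤ k) :
    |(overpartitionCount ((n : ℤ) - j ^ 2) : ℝ) - mainTerm n| ≤
      1000000 * (k : ℝ) ^ 2 * ((n : ℝ) ^ (-(1 / 4) : ℝ) * mainTerm n) := by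
  have hn' : (32 : ℝ) ≤ n := by exact_mod_cast hn
  have hn0 : (0 : ℝ) < n := by linarith
  have hjk : j.natAbs ^ 2 ≤ k ^ 2 := Nat.pow_le_pow_left hj 2
  have hjk' : ((j.natAbs ^ 2 : ℕ) : ℝ) ≤ (k : ℝ) ^ 2 := by exact_mod_cast hjk
  have hjn : ((j.natAbs ^ 2 : ℕ) : ℝ) ≤ n / 2 := hjk'.trans hkn
  set d := j.natAbs ^ 2 with hd
  have hdn : d ≤ n := by
    have : (d : ℝ) ≤ n := by linarith
    exact_mod_cast this
  have hcast : (n : ℤ) - j ^ 2 = ((n - d : ℕ) : ℤ) := by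
    rw [Nat.cast_sub hdn, hd, Nat.cast_pow, Int.natAbs_sq]
  have hcast' : ((n - d : ℕ) : ℝ) = n - d := Nat.cast_sub hdn
  have hm16 : 16 ≤ n - d := by
    have : (16 : ℝ) ≤ ((n - d : ℕ) : ℝ) := by rw [hcast']; linarith
    exact_mod_cast this
  have h1 := abs_overpartitionCount_sub_mainTerm_le hm16
  have h2 := abs_mainTerm_sub_mainTerm_le (n := n) (d := d) (by linarith) (Nat.cast_nonneg d) hjn
  rw [hcast'] at h1
  rw [hcast]
  set M := mainTerm n with hM
  have hM0 : 0 ≤ M := mainTerm_nonneg hn0.le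
  set P := (n : ℝ) ^ (-(1 / 4) : ℝ) with hP
  have hP0 : 0 < P := Real.rpow_pos_of_pos hn0 _
  have hk1 : (1 : ℝ) ≤ (k : ℝ) ^ 2 := one_le_pow₀ (by exact_mod_cast hk)
  have hsqrt : (d : ℝ) / √(n : ℝ) ≤ (k : ℝ) ^ 2 * P := by
    rw [div_eq_mul_inv]
    gcongr
    rw [hP, Real.sqrt_eq_rpow, ← Real.rpow_neg hn0.le]
    exact Real.rpow_le_rpow_of_exponent_le (by linarith) (by norm_num)
  have hpow : ((n : ℝ) - d) ^ (-(1 / 4) : ℝ) ≤ 2 * P := by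
    calc ((n : ℝ) - d) ^ (-(1 / 4) : ℝ) ≤ ((n : ℝ) / 2) ^ (-(1 / 4) : ℝ) :=
          Real.rpow_le_rpow_of_nonpos (by linarith) (by linarith) (by norm_num)
      _ = 2 ^ (1 / 4 : ℝ) * P := by
          rw [Real.div_rpow hn0.le (by norm_num), Real.rpow_neg (by norm_num : (0 : ℝ) ≤ 2),
            div_inv_eq_mul, mul_comm]
      _ ≤ 2 ^ (1 : ℝ) * P := by
          gcongr
          · norm_num
          · norm_num
      _ = 2 * P := by rw [Real.rpow_one]
  have hMm : mainTerm ((n : ℝ) - d) ≤ 4 * M := by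
    have h3 : mainTerm ((n : ℝ) - d) ≤ ((n : ℝ) / (n - d)) * M := by
      have hm0 : (0 : ℝ) < n - d := by linarith
      have e : ((n : ℝ) / (n - d)) * M = 1 / 8 * ((n : ℝ) - d)⁻¹ * Real.exp (Real.pi * √n) := by
        rw [hM, mainTerm]; field_simp
      rw [e, mainTerm]
      have := Real.pi_pos
      gcongr
      linarith [Nat.cast_nonneg (α := ℝ) d]
    refine h3.trans (mul_le_mul_of_nonneg_right ?_ hM0)
    rw [div_le_iff₀ (by linarith)]
    linarith
  have h3 : |(overpartitionCount ((n - d : ℕ) : ℤ) : ℝ) - mainTerm ((n : ℝ) - d)| ≤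
      904000 * (P * M) := by
    refine h1.trans ?_
    calc 113000 * (((n : ℝ) - d) ^ (-(1 / 4) : ℝ) * mainTerm ((n : ℝ) - d))
        ≤ 113000 * ((2 * P) * (4 * M)) := by
          gcongr
          exact mainTerm_nonneg (by linarith)
      _ = _ := by ring
  have h4 : 4 * (d / √(n : ℝ)) * M ≤ 4 * ((k : ℝ) ^ 2 * P) * M := by gcongr
  have hPM : P * M ≤ (k : ℝ) ^ 2 * (P * M) := le_mul_of_one_le_left (by positivity) hk1
  have hPM0 : 0 ≤ P * M := by positivity
  calc |(overpartitionCount ((n - d : ℕ) : ℤ) : ℝ) - M|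
      ≤ |(overpartitionCount ((n - d : ℕ) : ℤ) : ℝ) - mainTerm ((n : ℝ) - d)| +
        |mainTerm ((n : ℝ) - d) - M| := abs_sub_le _ _ _
    _ ≤ 904000 * (P * M) + 4 * ((k : ℝ) ^ 2 * P) * M := add_le_add h3 (h2.trans h4)
    _ ≤ _ := by nlinarith

lemma sum_Icc_neg_one_pow (k : ℕ) :
    ∑ j ∈ Icc (-(k : ℤ)) (k : ℤ), (-1 : ℝ) ^ j.natAbs = (-1) ^ k := by
  induction k with
  | zero => simp
  | succ k ih =>
    have e : Icc (-((k + 1 : ℕ) : ℤ)) ((k + 1 : ℕ) : ℤ) =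
        insert (-((k + 1 : ℕ) : ℤ)) (insert ((k + 1 : ℕ) : ℤ) (Icc (-(k : ℤ)) (k : ℤ))) := by
      ext j
      simp only [mem_insert, mem_Icc]
      omega
    have h1 : ((k + 1 : ℕ) : ℤ) ∉ Icc (-(k : ℤ)) (k : ℤ) := by
      simp only [mem_Icc]; omega
    have h2 : -((k + 1 : ℕ) : ℤ) ∉ insert ((k + 1 : ℕ) : ℤ) (Icc (-(k : ℤ)) (k : ℤ)) := by
      simp only [mem_insert, mem_Icc]; omega
    rw [e, sum_insert h2, sum_insert h1, ih, Int.natAbs_neg, Int.natAbs_natCast]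
    ring

/-- The main term of each summand is that of `p̄(n)`, and the signs add up to `1`. -/
lemma abs_truncatedOverpartition_sub_mainTerm_le {n k : ℕ} (hn : 32 ≤ n) (hk : 1 ≤ k)
    (hkn : (k : ℝ) ^ 2 ≤ n / 2) :
    |(truncatedOverpartition k n : ℝ) - mainTerm n| ≤
      3000000 * (k : ℝ) ^ 3 * ((n : ℝ) ^ (-(1 / 4) : ℝ) * mainTerm n) := by
  set B := (n : ℝ) ^ (-(1 / 4) : ℝ) * mainTerm n with hB
  have hB0 : 0 ≤ B := mul_nonneg (Real.rpow_nonneg (Nat.cast_nonneg n) _)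
    (mainTerm_nonneg (Nat.cast_nonneg n))
  have hk' : (1 : ℝ) ≤ k := by exact_mod_cast hk
  have hsign : ((-1 : ℝ) ^ k) * (-1) ^ k = 1 := by rw [← mul_pow]; norm_num
  have e : (truncatedOverpartition k n : ℝ) - mainTerm n =
      (-1) ^ k * ∑ j ∈ Icc (-(k : ℤ)) (k : ℤ),
        (-1) ^ j.natAbs * ((overpartitionCount ((n : ℤ) - j ^ 2) : ℝ) - mainTerm n) := by
    simp only [mul_sub]
    rw [sum_sub_distrib, ← sum_mul, sum_Icc_neg_one_pow, truncatedOverpartition]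
    push_cast
    linear_combination (-mainTerm n) * hsign.symm
  rw [e, abs_mul, abs_pow, abs_neg, abs_one, one_pow, one_mul]
  calc _ ≤ ∑ j ∈ Icc (-(k : ℤ)) (k : ℤ), 1000000 * (k : ℝ) ^ 2 * B := by
        refine (abs_sum_le_sum_abs _ _).trans (sum_le_sum fun j hj => ?_)
        rw [abs_mul, abs_pow, abs_neg, abs_one, one_pow, one_mul]
        refine abs_overpartitionCount_sub_sq_sub_mainTerm_le hn hk hkn ?_
        rw [mem_Icc] at hj
        omega
    _ = (2 * k + 1) * (1000000 * (k : ℝ) ^ 2 * B) := by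
        rw [sum_const, Int.card_Icc, nsmul_eq_mul]
        congr 1
        have : ((k : ℤ) + 1 - -(k : ℤ)).toNat = 2 * k + 1 := by omega
        rw [this]
        push_cast
        ring
    _ ≤ (3 * k) * (1000000 * (k : ℝ) ^ 2 * B) := by
        gcongr
        linarith
    _ = _ := by ring

theorem isEquivalent_mainTerm :
    Asymptotics.IsEquivalent atTop (fun n : ℕ => (overpartitionCount (n : ℤ) : ℝ))
      (fun n : ℕ => mainTerm n) := by
  have hO : (fun n : ℕ => (overpartitionCount (n : ℤ) : ℝ) - mainTerm n) =O[atTop]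
      fun n : ℕ => (n : ℝ) ^ (-(1 / 4) : ℝ) * mainTerm n := by
    refine Asymptotics.IsBigO.of_bound 113000 ?_
    filter_upwards [eventually_ge_atTop 16] with n hn
    rw [Real.norm_eq_abs, Real.norm_of_nonneg (mul_nonneg
      (Real.rpow_nonneg (Nat.cast_nonneg n) _) (mainTerm_nonneg (Nat.cast_nonneg n)))]
    exact abs_overpartitionCount_sub_mainTerm_le hn
  have ho : (fun n : ℕ => (n : ℝ) ^ (-(1 / 4) : ℝ)) =o[atTop] fun _ => (1 : ℝ) := by
    rw [Asymptotics.isLittleO_one_iff]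
    exact (tendsto_rpow_neg_atTop (by norm_num)).comp tendsto_natCast_atTop_atTop
  have := ho.mul_isBigO (Asymptotics.isBigO_refl (fun n : ℕ => mainTerm n) atTop)
  simp only [one_mul] at this
  exact hO.trans_isLittleO this

lemma sq_le_half_of_le_mul_rpow {C ε n k : ℝ} (hε : 0 < ε) (hC : 0 < C) (hn : 1 ≤ n)
    (hCn : 4 * C ^ 4 ≤ n) (hk : 0 ≤ k) (h : k ≤ C * n ^ ((1 : ℝ) / 12 - ε)) :
    k ^ 2 ≤ n / 2 := by
  have hn0 : 0 < n := by linarith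
  -- only `k = O(n ^ (1 / 4))` matters here, with a constant that `4 * C ^ 4 ≤ n` absorbs
  have h1 : k ≤ C * n ^ (1 / 4 : ℝ) := by
    refine h.trans ?_
    gcongr
    linarith
  have h2 : (n ^ (1 / 4 : ℝ)) ^ 2 = √n := by
    rw [← Real.rpow_natCast, ← Real.rpow_mul hn0.le, Real.sqrt_eq_rpow]
    norm_num
  have h3 : 2 * C ^ 2 ≤ √n := Real.le_sqrt_of_sq_le (by nlinarith)
  have h4 := Real.mul_self_sqrt hn0.le
  calc k ^ 2 ≤ (C * n ^ (1 / 4 : ℝ)) ^ 2 := by gcongr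
    _ = C ^ 2 * √n := by rw [mul_pow, h2]
    _ ≤ n / 2 := by nlinarith [Real.sqrt_nonneg n]

end Overpartition

theorem mainTheorem2 :
    (∀ ε : ℝ, 0 < ε → ∀ C : ℝ, 0 < C → ∃ K : ℝ, 0 < K ∧ ∃ N : ℕ, ∀ n k : ℕ, N ≤ n → 1 ≤ n → 1 ≤ k →
      (k : ℝ) ≤ C * (n : ℝ) ^ ((1 : ℝ) / 12 - ε) →
      |(truncatedOverpartition k n : ℝ)
          - (1 / 8 : ℝ) * (n : ℝ)⁻¹ * Real.exp (Real.pi * Real.sqrt (n : ℝ))|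
        ≤ K * ((k : ℝ) ^ 3 * (n : ℝ) ^ (-(5 : ℝ) / 4)
            * Real.exp (Real.pi * Real.sqrt (n : ℝ)))) ∧
    Asymptotics.IsEquivalent Filter.atTop
      (fun n : ℕ => (overpartitionCount (n : ℤ) : ℝ))
      (fun n : ℕ => (1 / 8 : ℝ) * (n : ℝ)⁻¹ * Real.exp (Real.pi * Real.sqrt (n : ℝ))) := by
  refine ⟨fun ε hε C hC => ⟨375000, by norm_num, max 32 ⌈4 * C ^ 4⌉₊, ?_⟩,
    Overpartition.isEquivalent_mainTerm⟩
  intro n k hN hn hk hkn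
  have hn32 : 32 ≤ n := (le_max_left _ _).trans hN
  have hCn : 4 * C ^ 4 ≤ (n : ℝ) :=
    (Nat.le_ceil _).trans (by exact_mod_cast (le_max_right _ _).trans hN)
  have hn0 : (0 : ℝ) < n := by exact_mod_cast hn
  have hk2 := Overpartition.sq_le_half_of_le_mul_rpow hε hC (by exact_mod_cast hn) hCn
    (Nat.cast_nonneg k) hkn
  refine (Overpartition.abs_truncatedOverpartition_sub_mainTerm_le hn32 hk hk2).trans
    (le_of_eq ?_)
  have e : (n : ℝ) ^ (-(5 : ℝ) / 4) = (n : ℝ) ^ (-(1 / 4) : ℝ) * (n : ℝ)⁻¹ := by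
    rw [← Real.rpow_neg_one (n : ℝ), ← Real.rpow_add hn0]
    norm_num
  rw [e, Overpartition.mainTerm]
  ring
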